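/- Let $p$ be a prime and let $\mathbb{Z}(p^\infty)$ be the Prüfer group, i.e. the subgroup of $\mathbb{Q}/\mathbb{Z}$ consisting of all elements of $p$-power order. For a topological group $G$, let $\rho_G\colon G\to bG$ be its Bohr compactification, i.e. the continuous homomorphism into a compact Hausdorff group through which every continuous homomorphism from $G$ into a compact Hausdorff group factors uniquely (by a continuous homomorphism), and let the von Neumann radical of $G$ be $\mathbf{n}(G)=\ker\rho_G$; equivalently, $\mathbf{n}(G)$ is the set of all $g\in G$ that lie in the kernel of every continuous homomorphism from $G$ into a compact Hausdorff group. Then for every non-zero element $x\in\mathbb{Z}(p^\infty)$ there is a Hausdorff group topology $\tau$ on $\mathbb{Z}(p^\infty)$ such that $\mathbf{n}(\mathbb{Z}(p^\infty),\tau)=\langle x\rangle$, the cyclic subgroup generated by $x$. -/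

import Mathlib

universe u

/-- The Prüfer group `ℤ(p^∞)`: the subgroup of `ℚ/ℤ` of all elements of `p`-power order.
It is a plain type with only a group structure; it carries no topology. -/
def PruferGroup (p : ℕ) : Type :=
  AddCommGroup.primaryComponent (ℚ ⧸ AddSubgroup.zmultiples (1 : ℚ)) p

noncomputable instance (p : ℕ) : AddCommGroup (PruferGroup p) :=
  inferInstanceAs
    (AddCommGroup (AddCommGroup.primaryComponent (ℚ ⧸ AddSubgroup.zmultiples (1 : ℚ)) p))

/-- `ρ : G → B` is a Bohr compactification of the topological group `G`: `B` is a compact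
Hausdorff group, `ρ` is a continuous homomorphism, and every continuous homomorphism from `G`
to a compact Hausdorff group factors uniquely through `ρ` by a continuous homomorphism. -/
structure IsBohrCompactification {G : Type u} [AddGroup G] [TopologicalSpace G]
    {B : Type u} [AddGroup B] [TopologicalSpace B] (ρ : G →+ B) : Prop where
  isTopologicalAddGroup : IsTopologicalAddGroup B
  compactSpace : CompactSpace B
  t2Space : T2Space B
  continuous : Continuous ρ
  existsUnique_factor : ∀ (K : Type u) [AddGroup K] [TopologicalSpace K]
    [IsTopologicalAddGroup K] [CompactSpace K] [T2Space K] (φ : G →+ K), Continuous φ →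
      ∃! ψ : B →+ K, Continuous ψ ∧ ψ.comp ρ = φ

/-- The von Neumann radical `n(G)` of a topological group `G` (written additively, not assumed
commutative): the elements killed by every continuous homomorphism into a compact Hausdorff
group. By `IsBohrCompactification.vonNeumannRadical_eq_ker` this is the kernel of the map
from `G` to its Bohr compactification. -/
def vonNeumannRadical (G : Type u) [AddGroup G] [TopologicalSpace G] : AddSubgroup G where
  carrier := {g | ∀ (K : Type u) [AddGroup K] [TopologicalSpace K] [IsTopologicalAddGroup K]
    [CompactSpace K] [T2Space K] (φ : G →+ K), Continuous φ → φ g = 0}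
  zero_mem' := by
    intro K _ _ _ _ _ φ _
    exact map_zero φ
  add_mem' := by
    intro a b ha hb K _ _ _ _ _ φ hφ
    rw [map_add, ha K φ hφ, hb K φ hφ, add_zero]
  neg_mem' := by
    intro a ha K _ _ _ _ _ φ hφ
    rw [map_neg, ha K φ hφ, neg_zero]

theorem IsBohrCompactification.vonNeumannRadical_eq_ker {G : Type u} [AddGroup G]
    [TopologicalSpace G] {B : Type u} [AddGroup B] [TopologicalSpace B] {ρ : G →+ B}
    (h : IsBohrCompactification ρ) : vonNeumannRadical G = ρ.ker := by
  have := h.isTopologicalAddGroup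
  have := h.compactSpace
  have := h.t2Space
  ext g
  constructor
  · intro hg
    exact hg B ρ h.continuous
  · intro hg K _ _ _ _ _ φ hφ
    obtain ⟨ψ, ⟨-, rfl⟩, -⟩ := h.existsUnique_factor K φ hφ
    rw [AddMonoidHom.comp_apply, (AddMonoidHom.mem_ker).1 hg, map_zero]

/-! Put `q = p ^ k`, where `⟨x⟩` is the `q`-torsion subgroup. The topology forces every `x +
evalSparse v` towards zero, where `v` runs over integer vectors on the `m`-th block that are `1` mod
`q` off a few coordinates, and `m → ∞`. Three facts decide the radical.

The sparse roots shrink so fast in the circle that `q • toCircle` contracts the generators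
(`norm_powCharacter_gen_le`). This character is therefore continuous, and its kernel `⟨x⟩` contains
the radical.

The topology is Hausdorff (`linearCombination_gen_eq_zero`). A `q`-torsion combination of length
below `1` has zero coefficient vector by sparseness. On each block it uses too few generators for
their exceptional coordinates to cover the block. At a common good coordinate the coefficients sum
to `0` mod `q`, so the multiple of `x` vanishes too.

Every continuous map to a compact group kills `x` (`map_eq_zero_of_small`). Finitely many translates
of a small neighbourhood colour the cube `(ZMod q) ^ d`. By concentration of measure some colour
class `C` comes Hamming-close to `C + 1`. Equally coloured `w ≈ w' + 1` give a nearly-one difference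
with small image, which makes the image of `x` small. -/

/-! ### Concentration of measure on Hamming cubes. -/

/-- A weak form of the Efron–Stein inequality for functions on a finite power `Q ^ n` that vary
by at most `1` along each coordinate. -/
theorem sum_sq_le_sq_sum_add_of_update {Q : Type*} [Fintype Q] [Nonempty Q] [DecidableEq Q] :
    ∀ (n : ℕ) (f : (Fin n → Q) → ℝ), (∀ w i a, |f (Function.update w i a) - f w| ≤ 1) →
      (∑ w, f w ^ 2) / (Fintype.card Q : ℝ) ^ n ≤
        ((∑ w, f w) / (Fintype.card Q : ℝ) ^ n) ^ 2 + n
  | 0, f, _ => by simp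
  | n + 1, f, hf => by
    set c : ℝ := (Fintype.card Q : ℝ) with hc
    have hc0 : 0 < c := by rw [hc]; exact_mod_cast Fintype.card_pos
    have hsplit : ∀ g : (Fin (n + 1) → Q) → ℝ,
        ∑ w, g w = ∑ w : Fin n → Q, ∑ a, g (Fin.cons a w) := fun g => by
      rw [← (Fin.consEquiv fun _ => Q).sum_comp, Fintype.sum_prod_type_right]
      rfl
    set F : (Fin n → Q) → ℝ := fun w => (∑ a, f (Fin.cons a w)) / c with hF
    have hFu : ∀ w i a, |F (Function.update w i a) - F w| ≤ 1 := fun w i a => by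
      rw [hF]
      simp only [Fin.cons_update, ← sub_div, ← Finset.sum_sub_distrib]
      rw [abs_div, abs_of_pos hc0, div_le_one hc0]
      calc _ ≤ ∑ b, |f (Function.update (Fin.cons b w) i.succ a) - f (Fin.cons b w)| :=
            Finset.abs_sum_le_sum_abs _ _
        _ ≤ ∑ b : Q, (1 : ℝ) := Finset.sum_le_sum fun b _ => hf _ _ _
        _ = c := by simp [hc]
    -- Along the first coordinate all values lie within `1` of their mean `F w`, so that coordinate
    -- adds at most `1` to the variance.
    have hvar : ∀ w, (∑ a, f (Fin.cons a w) ^ 2) / c ≤ F w ^ 2 + 1 := fun w => by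
      have hd : ∀ a, |f (Fin.cons a w) - F w| ≤ 1 := fun a => by
        have : f (Fin.cons a w) - F w =
            (∑ b, (f (Fin.cons a w) - f (Fin.cons b w))) / c := by
          rw [Finset.sum_sub_distrib, sub_div, hF]
          simp only [Finset.sum_const, Finset.card_univ, nsmul_eq_mul, ← hc]
          field_simp
        rw [this, abs_div, abs_of_pos hc0, div_le_one hc0]
        calc _ ≤ ∑ b, |f (Fin.cons a w) - f (Fin.cons b w)| := Finset.abs_sum_le_sum_abs _ _
          _ ≤ ∑ b : Q, (1 : ℝ) := Finset.sum_le_sum fun b _ => by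
              have := hf (Fin.cons b w) 0 a
              rwa [Fin.update_cons_zero] at this
          _ = c := by simp [hc]
      have hs : ∑ a, f (Fin.cons a w) = c * F w := by rw [hF]; field_simp
      have h1 : ∑ a, (f (Fin.cons a w) - F w) ^ 2 ≤ c := by
        calc _ ≤ ∑ b : Q, (1 : ℝ) := Finset.sum_le_sum fun a _ => by
              rw [← sq_abs]; exact pow_le_one₀ (abs_nonneg _) (hd a)
          _ = c := by simp [hc]
      have h2 : ∑ a, (f (Fin.cons a w) - F w) ^ 2 =
          ∑ a, f (Fin.cons a w) ^ 2 - 2 * F w * ∑ a, f (Fin.cons a w) + c * F w ^ 2 := by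
        simp only [sub_sq, Finset.sum_add_distrib, Finset.sum_sub_distrib, Finset.mul_sum,
          Finset.sum_const, Finset.card_univ, nsmul_eq_mul, ← hc]
        congr 2
        exact Finset.sum_congr rfl fun _ _ => by ring
      rw [div_le_iff₀ hc0]
      rw [h2, hs] at h1
      linarith
    have ih := sum_sq_le_sq_sum_add_of_update n F hFu
    have hcn : 0 < c ^ n := pow_pos hc0 n
    have e1 : (∑ w, f w) / c ^ (n + 1) = (∑ w, F w) / c ^ n := by
      rw [hsplit, hF, ← Finset.sum_div]
      field_simp
      ring
    have e2 : (∑ w, f w ^ 2) / c ^ (n + 1) = (∑ w : Fin n → Q, (∑ a, f (Fin.cons a w) ^ 2) / c) / c ^ n := by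
      rw [hsplit, ← Finset.sum_div]
      field_simp
      ring
    rw [e1, e2]
    calc _ ≤ (∑ w : Fin n → Q, (F w ^ 2 + 1)) / c ^ n := by
          gcongr with w; exact hvar w
      _ = (∑ w, F w ^ 2) / c ^ n + 1 := by
          rw [Finset.sum_add_distrib, add_div]
          simp [hc]
      _ ≤ _ := by push_cast; linarith

/-- Two subsets of `Q ^ d` of density at least `1 / n` have Hamming distance at most `t`
as soon as `4 n d ≤ t ^ 2`. -/
theorem exists_hammingDist_le {Q : Type*} [Fintype Q] [Nonempty Q] [DecidableEq Q] {d n t : ℕ}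
    (ht : 4 * n * d ≤ t ^ 2) (hn : 0 < n) (C D : Finset (Fin d → Q))
    (hC : Fintype.card Q ^ d ≤ n * C.card) (hD : Fintype.card Q ^ d ≤ n * D.card) :
    ∃ a ∈ C, ∃ b ∈ D, hammingDist a b ≤ t := by
  by_contra! hcon
  have hq : 0 < Fintype.card Q ^ d := pow_pos Fintype.card_pos d
  have hCn : C.Nonempty := by
    rw [← Finset.card_pos]
    by_contra h
    simp only [not_lt, Nat.le_zero] at h
    rw [h] at hC; omega
  set f : (Fin d → Q) → ℝ := fun w => ((C.inf' hCn fun c => hammingDist c w : ℕ) : ℝ) with hf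
  have hle : ∀ w i a, C.inf' hCn (fun c => hammingDist c w) ≤
      C.inf' hCn (fun c => hammingDist c (Function.update w i a)) + 1 := fun w i a => by
    obtain ⟨c, hc, he⟩ := C.exists_mem_eq_inf' hCn fun c => hammingDist c (Function.update w i a)
    rw [he]
    refine (Finset.inf'_le _ hc).trans ((hammingDist_triangle c (Function.update w i a) w).trans ?_)
    gcongr
    unfold hammingDist
    calc _ ≤ ({i} : Finset (Fin d)).card := Finset.card_le_card fun j hj => by
          by_contra hji
          simp only [Finset.mem_singleton] at hji
          simp [Function.update_of_ne hji] at hj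
      _ = 1 := Finset.card_singleton i
  have hfu : ∀ w i a, |f (Function.update w i a) - f w| ≤ 1 := fun w i a => by
    have h1 := hle w i a
    have h2 := hle (Function.update w i a) i (w i)
    rw [Function.update_idem, Function.update_eq_self] at h2
    rw [abs_le]
    simp only [hf]
    have h1' : ((C.inf' hCn fun c => hammingDist c w : ℕ) : ℝ) ≤
      (C.inf' hCn (fun c => hammingDist c (Function.update w i a)) : ℕ) + 1 := by exact_mod_cast h1
    have h2' : ((C.inf' hCn (fun c => hammingDist c (Function.update w i a)) : ℕ) : ℝ) ≤
      (C.inf' hCn fun c => hammingDist c w : ℕ) + 1 := by exact_mod_cast h2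
    constructor <;> linarith
  have hvar := sum_sq_le_sq_sum_add_of_update d f hfu
  set c : ℝ := (Fintype.card Q : ℝ) ^ d with hc
  have hc0 : 0 < c := by rw [hc]; exact_mod_cast hq
  set μ : ℝ := (∑ w, f w) / c with hμ
  have hs : ∑ w, f w = c * μ := by rw [hμ]; field_simp
  have hdev : ∑ w, (f w - μ) ^ 2 ≤ d * c := by
    have : ∑ w, (f w - μ) ^ 2 = ∑ w, f w ^ 2 - 2 * μ * ∑ w, f w + c * μ ^ 2 := by
      simp only [sub_sq, Finset.sum_add_distrib, Finset.sum_sub_distrib, Finset.mul_sum,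
        Finset.sum_const, Finset.card_univ, nsmul_eq_mul, Fintype.card_fun, Fintype.card_fin]
      congr 2
      · exact Finset.sum_congr rfl fun _ _ => by ring
      · rw [hc]; push_cast; rfl
    rw [div_le_iff₀ hc0] at hvar
    rw [this, hs]
    linarith
  -- Chebyshev: on a set of density at least `1 / n` the squared deviation cannot exceed `n * d`
  -- everywhere.
  have key : ∀ (A : Finset (Fin d → Q)) (s : ℝ), Fintype.card Q ^ d ≤ n * A.card →
      (∀ w ∈ A, s ≤ (f w - μ) ^ 2) → s ≤ n * d := fun A s hA hsA => by
    rcases lt_or_ge s 0 with h0 | h0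
    · exact h0.le.trans (by positivity)
    have h1 : A.card * s ≤ d * c := by
      calc A.card * s = ∑ w ∈ A, s := by simp
        _ ≤ ∑ w ∈ A, (f w - μ) ^ 2 := Finset.sum_le_sum hsA
        _ ≤ ∑ w, (f w - μ) ^ 2 :=
          Finset.sum_le_sum_of_subset_of_nonneg (Finset.subset_univ _) fun _ _ _ => sq_nonneg _
        _ ≤ _ := hdev
    have h2 : c ≤ n * A.card := by rw [hc]; exact_mod_cast hA
    have h3 : c * s ≤ c * (n * d) := by
      calc c * s ≤ n * A.card * s := by gcongr
        _ = n * (A.card * s) := by ring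
        _ ≤ n * (d * c) := by gcongr
        _ = _ := by ring
    exact le_of_mul_le_mul_left h3 hc0
  have hf0 : ∀ w ∈ C, f w = 0 := fun w hw => by
    simp only [hf, Nat.cast_eq_zero]
    have := Finset.inf'_le (fun c => hammingDist c w) hw
    simpa using this
  have hfD : ∀ w ∈ D, (t : ℝ) + 1 ≤ f w := fun w hw => by
    simp only [hf]
    have : t + 1 ≤ C.inf' hCn fun c => hammingDist c w :=
      (Finset.le_inf'_iff _ _).2 fun a ha => hcon a ha w hw
    exact_mod_cast this
  have hμC : μ ^ 2 ≤ n * d := key C _ hC fun w hw => by rw [hf0 w hw]; simp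
  have ht' : (4 : ℝ) * n * d ≤ t ^ 2 := by exact_mod_cast ht
  have hμt : μ ≤ t / 2 := by
    refine (abs_le_of_sq_le_sq' ?_ (by positivity)).2
    nlinarith
  have hμD : ((t : ℝ) / 2 + 1) ^ 2 ≤ n * d := key D _ hD fun w hw => by
    have := hfD w hw
    gcongr
    linarith
  -- `(t / 2 + 1) ^ 2 ≤ n * d ≤ t ^ 2 / 4` is absurd.
  nlinarith [(Nat.cast_nonneg t : (0 : ℝ) ≤ t)]

/-! ### Group topologies from weighted generators. -/

section WeightedBall

variable {ι G : Type*} [AddCommGroup G]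

/-- The weighted `ℓ¹` length of a formal integer combination. -/
noncomputable def weightedLength (w : ι → ℝ) (n : ι →₀ ℤ) : ℝ :=
  n.sum fun i c => |(c : ℝ)| * w i

theorem weightedLength_add_le {w : ι → ℝ} (hw : ∀ i, 0 ≤ w i) (n n' : ι →₀ ℤ) :
    weightedLength w (n + n') ≤ weightedLength w n + weightedLength w n' := by
  classical
  unfold weightedLength
  rw [Finsupp.sum_of_support_subset (n + n') Finsupp.support_add _ (by simp),
    Finsupp.sum_of_support_subset n (Finset.subset_union_left (s₂ := n'.support)) _ (by simp),
    Finsupp.sum_of_support_subset n' (Finset.subset_union_right (s₁ := n.support)) _ (by simp),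
    ← Finset.sum_add_distrib]
  refine Finset.sum_le_sum fun i _ => ?_
  rw [← add_mul, Finsupp.add_apply, Int.cast_add]
  exact mul_le_mul_of_nonneg_right (abs_add_le _ _) (hw i)

theorem weightedLength_neg (w : ι → ℝ) (n : ι →₀ ℤ) :
    weightedLength w (-n) = weightedLength w n := by
  simp [weightedLength, Finsupp.sum, Finsupp.support_neg]

theorem weightedLength_single (w : ι → ℝ) (i : ι) :
    weightedLength w (Finsupp.single i 1) = w i := by
  simp [weightedLength]

/-- The elements of `G` which are combinations of the `γ i` of weighted length less than `ε`. -/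
def weightedBall (w : ι → ℝ) (γ : ι → G) (ε : ℝ) : Set G :=
  {g | ∃ n : ι →₀ ℤ, weightedLength w n < ε ∧ Finsupp.linearCombination ℤ γ n = g}

theorem mem_weightedBall {w : ι → ℝ} {γ : ι → G} {ε : ℝ} {i : ι} (h : w i < ε) :
    γ i ∈ weightedBall w γ ε :=
  ⟨Finsupp.single i 1, by rwa [weightedLength_single], by simp⟩

/-- The group topology whose neighbourhoods of zero are the weighted balls. -/
@[reducible] def weightedBasis (w : ι → ℝ) (hw : ∀ i, 0 ≤ w i) (γ : ι → G) : AddGroupFilterBasis G where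
  sets := {U | ∃ ε > 0, U = weightedBall w γ ε}
  nonempty := ⟨_, 1, one_pos, rfl⟩
  inter_sets := by
    rintro _ _ ⟨ε, hε, rfl⟩ ⟨δ, hδ, rfl⟩
    refine ⟨_, ⟨min ε δ, lt_min hε hδ, rfl⟩, ?_⟩
    rintro g ⟨n, hn, rfl⟩
    exact ⟨⟨n, hn.trans_le (min_le_left _ _), rfl⟩, ⟨n, hn.trans_le (min_le_right _ _), rfl⟩⟩
  zero' := by
    rintro _ ⟨ε, hε, rfl⟩
    exact ⟨0, by simpa [weightedLength] using hε, map_zero _⟩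
  add' := by
    rintro _ ⟨ε, hε, rfl⟩
    refine ⟨_, ⟨ε / 2, half_pos hε, rfl⟩, ?_⟩
    rintro _ ⟨_, ⟨n, hn, rfl⟩, _, ⟨n', hn', rfl⟩, rfl⟩
    exact ⟨n + n', (weightedLength_add_le hw n n').trans_lt (by linarith), map_add _ _ _⟩
  neg' := by
    rintro _ ⟨ε, hε, rfl⟩
    refine ⟨_, ⟨ε, hε, rfl⟩, ?_⟩
    rintro _ ⟨n, hn, rfl⟩
    exact ⟨-n, by rwa [weightedLength_neg], map_neg _ _⟩
  conj' := by
    rintro g _ ⟨ε, hε, rfl⟩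
    refine ⟨_, ⟨ε, hε, rfl⟩, ?_⟩
    intro h hh
    simpa using hh

theorem weightedBasis_hasBasis (w : ι → ℝ) (hw : ∀ i, 0 ≤ w i) (γ : ι → G) :
    (@nhds G (weightedBasis w hw γ).topology 0).HasBasis (fun ε : ℝ => 0 < ε)
      (weightedBall w γ) := by
  refine ⟨fun s => ?_⟩
  rw [(weightedBasis w hw γ).nhds_zero_hasBasis.mem_iff]
  constructor
  · rintro ⟨_, ⟨ε, hε, rfl⟩, h⟩
    exact ⟨ε, hε, h⟩
  · rintro ⟨ε, hε, h⟩
    exact ⟨_, ⟨ε, hε, rfl⟩, h⟩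

/-- A homomorphism into a seminormed group that contracts every generator contracts
weighted balls. -/
theorem norm_lt_of_mem_weightedBall {E : Type*} [SeminormedAddCommGroup E] {w : ι → ℝ}
    {γ : ι → G} (χ : G →+ E) (hχ : ∀ i, ‖χ (γ i)‖ ≤ w i) {ε : ℝ} {g : G}
    (hg : g ∈ weightedBall w γ ε) : ‖χ g‖ < ε := by
  obtain ⟨n, hn, rfl⟩ := hg
  refine lt_of_le_of_lt ?_ hn
  rw [Finsupp.linearCombination_apply, Finsupp.sum, map_sum]
  refine (norm_sum_le _ _).trans (Finset.sum_le_sum fun i _ => ?_)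
  rw [map_zsmul]
  refine (norm_zsmul_le _ _).trans ?_
  change ‖n i‖ * _ ≤ |(n i : ℝ)| * w i
  rw [← Int.norm_eq_abs]
  exact mul_le_mul_of_nonneg_left (hχ i) (norm_nonneg _)

end WeightedBall

/-! ### Arithmetic of the Prüfer group. -/

namespace PruferGroup

/-- The embedding of the Prüfer group into the circle `ℝ/ℤ`. -/
noncomputable def toCircle (p : ℕ) : PruferGroup p →+ UnitAddCircle :=
  (QuotientAddGroup.map (AddSubgroup.zmultiples (1 : ℚ)) (AddSubgroup.zmultiples (1 : ℝ))
    (Rat.castHom ℝ).toAddMonoidHom (by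
      rw [AddSubgroup.zmultiples_le]
      simp [AddSubgroup.mem_comap])).comp
    (AddCommGroup.primaryComponent (ℚ ⧸ AddSubgroup.zmultiples (1 : ℚ)) p).subtype

theorem toCircle_injective (p : ℕ) : Function.Injective (toCircle p) := by
  rw [injective_iff_map_eq_zero]
  rintro ⟨g, hg⟩ h
  obtain ⟨r, rfl⟩ := QuotientAddGroup.mk_surjective g
  have h' : ((r : ℝ) : UnitAddCircle) = 0 := h
  rw [AddCircle.coe_eq_zero_iff] at h'
  obtain ⟨n, hn⟩ := h'
  apply Subtype.ext
  refine (QuotientAddGroup.eq_zero_iff r).2 ⟨n, ?_⟩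
  simp only [zsmul_eq_mul, mul_one] at hn ⊢
  exact_mod_cast hn

/-- The class of `1 / p ^ n`. -/
noncomputable def root (p : ℕ) [Fact p.Prime] (n : ℕ) : PruferGroup p :=
  (⟨((1 / (p : ℚ) ^ n : ℚ) : ℚ ⧸ AddSubgroup.zmultiples (1 : ℚ)), by
    have hp : (p : ℚ) ≠ 0 := by exact_mod_cast (Fact.out : p.Prime).ne_zero
    have h : p ^ n • ((1 / (p : ℚ) ^ n : ℚ) : ℚ ⧸ AddSubgroup.zmultiples (1 : ℚ)) = 0 := by
      rw [← QuotientAddGroup.mk_nsmul, QuotientAddGroup.eq_zero_iff]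
      refine ⟨1, ?_⟩
      simp only [nsmul_eq_mul, one_smul]
      push_cast
      field_simp
    exact ⟨n, h⟩⟩ :
    AddCommGroup.primaryComponent (ℚ ⧸ AddSubgroup.zmultiples (1 : ℚ)) p)

variable (p : ℕ) [Fact p.Prime]

theorem toCircle_root (n : ℕ) : toCircle p (root p n) = ((1 / (p : ℝ) ^ n : ℝ) : UnitAddCircle) := by
  have : toCircle p (root p n) = (((1 / (p : ℚ) ^ n : ℚ) : ℝ) : UnitAddCircle) := rfl
  rw [this]
  push_cast
  rfl

theorem zsmul_root_eq_zero_iff (n : ℕ) (c : ℤ) : c • root p n = 0 ↔ (p : ℤ) ^ n ∣ c := by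
  have hp : (p : ℝ) ≠ 0 := by exact_mod_cast (Fact.out : p.Prime).ne_zero
  rw [← (toCircle_injective p).eq_iff, map_zsmul, toCircle_root, map_zero, ← AddCircle.coe_zsmul,
    AddCircle.coe_eq_zero_iff]
  simp only [zsmul_eq_mul, mul_one]
  refine exists_congr fun d => ?_
  rw [mul_one_div, eq_div_iff (pow_ne_zero n hp), eq_comm, mul_comm]
  exact_mod_cast Iff.rfl

theorem pow_zsmul_root_add (n m : ℕ) : ((p : ℤ) ^ m) • root p (n + m) = root p n := by
  have hp : (p : ℝ) ≠ 0 := by exact_mod_cast (Fact.out : p.Prime).ne_zero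
  apply toCircle_injective p
  rw [map_zsmul, toCircle_root, toCircle_root, ← AddCircle.coe_zsmul]
  congr 1
  simp only [zsmul_eq_mul]
  push_cast
  field_simp
  ring

theorem exists_eq_zsmul_root (g : PruferGroup p) : ∃ (n : ℕ) (c : ℤ), g = c • root p n := by
  have hp : (p : ℚ) ≠ 0 := by exact_mod_cast (Fact.out : p.Prime).ne_zero
  obtain ⟨g, k, hk⟩ := g
  obtain ⟨r, rfl⟩ := QuotientAddGroup.mk_surjective g
  have h : p ^ k • (r : ℚ ⧸ AddSubgroup.zmultiples (1 : ℚ)) = 0 := by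
    exact hk
  rw [← QuotientAddGroup.mk_nsmul, QuotientAddGroup.eq_zero_iff] at h
  obtain ⟨c, hc⟩ := h
  refine ⟨k, c, Subtype.ext ?_⟩
  change (r : ℚ ⧸ AddSubgroup.zmultiples (1 : ℚ)) =
    c • ((1 / (p : ℚ) ^ k : ℚ) : ℚ ⧸ AddSubgroup.zmultiples (1 : ℚ))
  rw [← QuotientAddGroup.mk_zsmul]
  congr 1
  simp only [zsmul_eq_mul, mul_one, nsmul_eq_mul] at hc ⊢
  push_cast at hc
  rw [hc]
  field_simp

/-- Every cyclic subgroup of the Prüfer group is the full `p ^ k`-torsion subgroup for some `k`. -/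
theorem exists_zmultiples_eq_torsion (x : PruferGroup p) :
    ∃ k : ℕ, ∀ g, g ∈ AddSubgroup.zmultiples x ↔ ((p : ℤ) ^ k) • g = 0 := by
  classical
  have hex : ∃ n, ∃ c : ℤ, x = c • root p n := exists_eq_zsmul_root p x
  obtain ⟨c, hc⟩ := Nat.find_spec hex
  -- Minimality of `k` makes `c` prime to `p`, hence invertible mod `p ^ k`.
  set k := Nat.find hex with hk
  have hkx : ((p : ℤ) ^ k) • x = 0 := by
    rw [hc, smul_smul, zsmul_root_eq_zero_iff]
    exact dvd_mul_right _ _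
  have hroot : root p k ∈ AddSubgroup.zmultiples x := by
    have hcop : IsCoprime c ((p : ℤ) ^ k) := by
      rcases Nat.eq_zero_or_pos k with h0 | h0
      · rw [h0, pow_zero]; exact isCoprime_one_right
      apply IsCoprime.pow_right
      rw [isCoprime_comm, (Nat.prime_iff_prime_int.1 Fact.out).coprime_iff_not_dvd]
      rintro ⟨d, rfl⟩
      refine Nat.find_min hex (show k - 1 < k by omega) ⟨d, ?_⟩
      rw [hc, mul_comm, mul_smul]
      have := pow_zsmul_root_add p (k - 1) 1
      rw [Nat.sub_add_cancel h0, pow_one] at this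
      rw [this]
    obtain ⟨a, b, hab⟩ := hcop
    refine ⟨a, ?_⟩
    change a • x = root p k
    have hb : (b * (p : ℤ) ^ k) • root p k = 0 :=
      (zsmul_root_eq_zero_iff p k _).2 (dvd_mul_left _ _)
    calc a • x = (a * c) • root p k + (b * (p : ℤ) ^ k) • root p k := by
          rw [hb, add_zero, hc, smul_smul]
      _ = root p k := by rw [← add_smul, hab, one_smul]
  refine ⟨k, fun g => ⟨?_, fun hg => ?_⟩⟩
  · rintro ⟨a, rfl⟩
    change ((p : ℤ) ^ k) • a • x = 0
    rw [smul_comm, hkx, smul_zero]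
  · obtain ⟨n, d, rfl⟩ := exists_eq_zsmul_root p g
    rcases le_total n k with hnk | hnk
    · obtain ⟨j, hj⟩ := Nat.exists_eq_add_of_le hnk
      rw [← pow_zsmul_root_add p n j, ← hj]
      exact zsmul_mem (zsmul_mem hroot _) _
    · obtain ⟨j, rfl⟩ := Nat.exists_eq_add_of_le hnk
      have hp : (p : ℤ) ≠ 0 := by exact_mod_cast (Fact.out : p.Prime).ne_zero
      rw [smul_smul, zsmul_root_eq_zero_iff, pow_add] at hg
      obtain ⟨e, rfl⟩ := (mul_dvd_mul_iff_left (pow_ne_zero k hp)).1 hg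
      rw [mul_comm, mul_smul, pow_zsmul_root_add]
      exact zsmul_mem hroot _

theorem norm_toCircle_root_le (n : ℕ) : ‖toCircle p (root p n)‖ ≤ 1 / (p : ℝ) ^ n := by
  rw [toCircle_root]
  refine (QuotientAddGroup.norm_mk_le_norm).trans ?_
  rw [Real.norm_of_nonneg (by positivity)]

end PruferGroup

/-! ### Blocks, sparse exponents and generators. -/

namespace PruferGroup

/-- The number of coordinates in the `m`-th block. -/
def blockSize (m : ℕ) : ℕ := 4 * (m + 1) ^ 3

/-- The number of exceptional coordinates allowed in the `m`-th block. -/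
def defect (m : ℕ) : ℕ := 4 * (m + 1) ^ 2

/-- The positions of the coordinates of the `m`-th block. -/
def blockEmb (m : ℕ) : Fin (blockSize m) ↪ ℕ :=
  ⟨fun i => Nat.pair m i, fun _ _ h => Fin.ext (Nat.pair_eq_pair.1 h).2⟩

/-- The `m`-th block; distinct blocks are disjoint. -/
def block (m : ℕ) : Finset ℕ := Finset.univ.map (blockEmb m)

theorem card_block (m : ℕ) : (block m).card = blockSize m := by simp [block]

theorem unpair_fst_of_mem_block {m a : ℕ} (h : a ∈ block m) : (Nat.unpair a).1 = m := by
  obtain ⟨i, -, rfl⟩ := Finset.mem_map.1 h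
  exact congrArg Prod.fst (Nat.unpair_pair m i)

theorem le_of_mem_block {m a : ℕ} (h : a ∈ block m) : m ≤ a := by
  rw [← unpair_fst_of_mem_block h]
  exact Nat.unpair_left_le a

/-- A rapidly increasing sequence of exponents. -/
def depth (p k n : ℕ) : ℕ :=
  ∑ j ∈ Finset.range n, (2 * k + (j + 1) * blockSize j * (p ^ k) ^ 2 + (j + 1))

theorem depth_succ (p k n : ℕ) : depth p k (n + 1) =
    depth p k n + (2 * k + (n + 1) * blockSize n * (p ^ k) ^ 2 + (n + 1)) :=
  Finset.sum_range_succ _ _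

theorem depth_mono (p k : ℕ) : Monotone (depth p k) :=
  monotone_nat_of_le_succ fun n => by rw [depth_succ]; omega

/-- An integer vector supported on the `m`-th block, bounded by `q`, almost all of whose
coordinates in the block are congruent to `1` modulo `q`. -/
structure IsNearlyOne (q : ℕ) (m : ℕ) (v : ℕ →₀ ℤ) : Prop where
  support_subset : v.support ⊆ block m
  abs_le : ∀ a, |v a| ≤ q
  card_le : ((block m).filter fun a => ¬ (q : ℤ) ∣ v a - 1).card ≤ defect m

variable (p k : ℕ)

/-- The index set of the generators made small by the topology. -/
abbrev GenIndex : Type := {e : ℕ × (ℕ →₀ ℤ) // IsNearlyOne (p ^ k) e.1 e.2}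

variable {p k} in
/-- The weight of a generator. -/
noncomputable def genWeight (e : GenIndex p k) : ℝ := 1 / ((e.1.1 : ℝ) + 1)

variable {p k} in
theorem genWeight_nonneg (e : GenIndex p k) : 0 ≤ genWeight e := by
  unfold genWeight; positivity

/-- The character `p ^ k • toCircle`. -/
noncomputable def powCharacter : PruferGroup p →+ UnitAddCircle :=
  ((p : ℤ) ^ k) • toCircle p

theorem powCharacter_eq_zero_iff (g : PruferGroup p) :
    powCharacter p k g = 0 ↔ ((p : ℤ) ^ k) • g = 0 := by
  rw [← (toCircle_injective p).eq_iff, map_zsmul, map_zero]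
  rfl

variable [Fact p.Prime]

/-- Evaluation of integer vectors at the sparse sequence `root p (depth p k (a + 1))`. -/
noncomputable def evalSparse : (ℕ →₀ ℤ) →ₗ[ℤ] PruferGroup p :=
  Finsupp.linearCombination ℤ fun a => root p (depth p k (a + 1))

/-- Multiplying by `p ^ depth p k A`, with `A` the top index, kills all lower terms. The gap up to
the next depth then divides `p ^ k * c A`, which is too small; the summands `2 * k` and `n + 1` of
`depth` serve this. -/
theorem eq_zero_of_evalSparse_torsion (c : ℕ →₀ ℤ) (hc : ∀ a, |c a| ≤ (a + 1) * (p : ℤ) ^ k)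
    (h : ((p : ℤ) ^ k) • evalSparse p k c = 0) : c = 0 := by
  by_contra hne
  have hsupp : c.support.Nonempty := Finsupp.support_nonempty_iff.2 hne
  set A := c.support.max' hsupp with hA
  have hAmem : A ∈ c.support := Finset.max'_mem _ _
  have hp : (p : ℤ) ≠ 0 := by exact_mod_cast (Fact.out : p.Prime).ne_zero
  have h2 : (2 : ℤ) ≤ p := by exact_mod_cast (Fact.out : p.Prime).two_le
  have hsum : ((p : ℤ) ^ depth p k A * ((p : ℤ) ^ k * c A)) • root p (depth p k (A + 1)) = 0 := by
    have h' : ((p : ℤ) ^ depth p k A) • ((p : ℤ) ^ k) • evalSparse p k c = 0 := by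
      rw [h, smul_zero]
    rw [evalSparse, Finsupp.linearCombination_apply, Finsupp.sum, Finset.smul_sum,
      Finset.smul_sum, Finset.sum_eq_single A] at h'
    · rwa [smul_smul, smul_smul, mul_assoc] at h'
    · intro a ha haA
      rw [smul_smul, smul_smul, zsmul_root_eq_zero_iff]
      have hlt : a + 1 ≤ A := lt_of_le_of_ne (Finset.le_max' _ _ ha) haA
      exact Dvd.dvd.mul_right (Dvd.dvd.mul_right (pow_dvd_pow _ (depth_mono p k hlt)) _) _
    · intro hn; exact absurd hAmem hn
  rw [zsmul_root_eq_zero_iff, depth_succ, pow_add,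
    mul_dvd_mul_iff_left (pow_ne_zero _ hp)] at hsum
  have hlt : |(p : ℤ) ^ k * c A| <
      (p : ℤ) ^ (2 * k + (A + 1) * blockSize A * (p ^ k) ^ 2 + (A + 1)) := by
    have hq : (0 : ℤ) < (p : ℤ) ^ k := by positivity
    have hA2 : ((A : ℤ) + 1) < (p : ℤ) ^ (A + 1) := by
      have := Nat.lt_pow_self (n := A + 1) (Fact.out : p.Prime).one_lt
      exact_mod_cast this
    calc |(p : ℤ) ^ k * c A| = (p : ℤ) ^ k * |c A| := by rw [abs_mul, abs_of_pos hq]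
      _ ≤ (p : ℤ) ^ k * ((A + 1) * (p : ℤ) ^ k) := by gcongr; exact hc A
      _ = (p : ℤ) ^ (2 * k) * (A + 1) := by ring
      _ < (p : ℤ) ^ (2 * k) * (p : ℤ) ^ (A + 1) := by gcongr
      _ = (p : ℤ) ^ (2 * k + (A + 1)) := (pow_add _ _ _).symm
      _ ≤ _ := pow_le_pow_right₀ (by linarith) (by omega)
  have h0 := Int.eq_zero_of_abs_lt_dvd hsum hlt
  rcases mul_eq_zero.1 h0 with h0 | h0
  · exact pow_ne_zero _ hp h0
  · exact Finsupp.mem_support_iff.1 hAmem h0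

variable {p k} in
/-- The generators: translates by `x` of the values of nearly-one vectors. -/
noncomputable def gen (x : PruferGroup p) (e : GenIndex p k) : PruferGroup p :=
  x + evalSparse p k e.1.2

variable {p k}

/-- The character kills `x`, and the middle summand of `depth` makes each of the at most `blockSize
m` terms at most `1 / ((m + 1) * blockSize m)`. -/
theorem norm_powCharacter_gen_le {x : PruferGroup p} (hx : ((p : ℤ) ^ k) • x = 0)
    (e : GenIndex p k) : ‖powCharacter p k (gen x e)‖ ≤ genWeight e := by
  obtain ⟨⟨m, v⟩, hv⟩ := e
  have hp0 : 0 < p := (Fact.out : p.Prime).pos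
  rw [gen, map_add, (powCharacter_eq_zero_iff p k x).2 hx, zero_add, evalSparse,
    Finsupp.linearCombination_apply, Finsupp.sum, map_sum]
  have hM : (0 : ℝ) < blockSize m := by unfold blockSize; positivity
  calc _ ≤ ∑ a ∈ v.support, ‖powCharacter p k (v a • root p (depth p k (a + 1)))‖ :=
        norm_sum_le _ _
    _ ≤ ∑ a ∈ v.support, 1 / (((m : ℝ) + 1) * blockSize m) := by
        refine Finset.sum_le_sum fun a ha => ?_
        have hma : m ≤ a := le_of_mem_block (hv.support_subset ha)
        rw [map_zsmul]
        refine (norm_zsmul_le _ _).trans ?_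
        have h1 : ‖v a‖ ≤ (p : ℝ) ^ k := by
          rw [Int.norm_eq_abs]; exact_mod_cast hv.abs_le a
        have h2 : ‖powCharacter p k (root p (depth p k (a + 1)))‖ ≤
            (p : ℝ) ^ k * (1 / (p : ℝ) ^ depth p k (a + 1)) := by
          change ‖((p : ℤ) ^ k) • toCircle p _‖ ≤ _
          refine (norm_zsmul_le _ _).trans ?_
          rw [Int.norm_eq_abs]
          push_cast
          rw [abs_of_nonneg (by positivity)]
          gcongr
          exact norm_toCircle_root_le p _
        have h3 : ((m : ℝ) + 1) * blockSize m * ((p : ℝ) ^ k) ^ 2 ≤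
            (p : ℝ) ^ depth p k (a + 1) := by
          have h4 : (m + 1) * blockSize m * (p ^ k) ^ 2 ≤ depth p k (a + 1) := by
            refine le_trans ?_ (depth_mono p k (Nat.succ_le_succ hma))
            rw [depth_succ]; omega
          exact_mod_cast h4.trans (Nat.lt_pow_self (Fact.out : p.Prime).one_lt).le
        have hpR : (0 : ℝ) < p := by exact_mod_cast hp0
        calc _ ≤ (p : ℝ) ^ k * ((p : ℝ) ^ k * (1 / (p : ℝ) ^ depth p k (a + 1))) := by gcongr
          _ ≤ (p : ℝ) ^ k * ((p : ℝ) ^ k *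
              (1 / (((m : ℝ) + 1) * blockSize m * ((p : ℝ) ^ k) ^ 2))) := by gcongr
          _ = _ := by field_simp
    _ = v.support.card * (1 / (((m : ℝ) + 1) * blockSize m)) := by simp
    _ ≤ blockSize m * (1 / (((m : ℝ) + 1) * blockSize m)) := by
        gcongr
        rw [← card_block]
        exact Finset.card_le_card hv.support_subset
    _ = _ := by unfold genWeight; field_simp

theorem linearCombination_gen (x : PruferGroup p) (n : GenIndex p k →₀ ℤ) :
    Finsupp.linearCombination ℤ (gen x) n =
      (∑ e ∈ n.support, n e) • x + evalSparse p k (∑ e ∈ n.support, n e • e.1.2) := by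
  rw [Finsupp.linearCombination_apply, Finsupp.sum, Finset.sum_smul, map_sum,
    ← Finset.sum_add_distrib]
  exact Finset.sum_congr rfl fun e _ => by rw [gen, smul_add, map_zsmul]

/-- Short combinations of the generators never hit a non-zero element of the `p ^ k`-torsion. -/
theorem linearCombination_gen_eq_zero {x : PruferGroup p} (hx : ((p : ℤ) ^ k) • x = 0)
    (n : GenIndex p k →₀ ℤ) (hn : weightedLength genWeight n < 1)
    (h : ((p : ℤ) ^ k) • Finsupp.linearCombination ℤ (gen x) n = 0) :
    Finsupp.linearCombination ℤ (gen x) n = 0 := by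
  classical
  set F : ℕ → Finset (GenIndex p k) := fun m => n.support.filter fun e => e.1.1 = m with hF
  -- Length below `1` gives an integer strictly below `m + 1`. The sharp bound `m` matters: `(m + 1)
  -- * defect m` already equals `blockSize m`.
  have hFsum : ∀ m : ℕ, ∑ e ∈ F m, |n e| ≤ m := fun m => by
    have h1 : ((∑ e ∈ F m, |n e| : ℤ) : ℝ) * (1 / ((m : ℝ) + 1)) ≤ weightedLength genWeight n := by
      push_cast
      rw [Finset.sum_mul]
      calc _ = ∑ e ∈ F m, |(n e : ℝ)| * genWeight e :=
            Finset.sum_congr rfl fun e he => by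
              rw [genWeight, (Finset.mem_filter.1 he).2]
        _ ≤ _ := Finset.sum_le_sum_of_subset_of_nonneg (Finset.filter_subset _ _) fun e _ _ =>
            mul_nonneg (abs_nonneg _) (genWeight_nonneg e)
    have h2 := h1.trans_lt hn
    rw [mul_one_div, div_lt_one (by positivity)] at h2
    have h3 : ∑ e ∈ F m, |n e| < (m : ℤ) + 1 := by exact_mod_cast h2
    omega
  set c : ℕ →₀ ℤ := ∑ e ∈ n.support, n e • e.1.2 with hc
  have hca : ∀ m a, a ∈ block m → c a = ∑ e ∈ F m, n e * e.1.2 a := fun m a ha => by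
    rw [hc, Finsupp.finsetSum_apply, hF]
    simp only [Finsupp.smul_apply, smul_eq_mul]
    rw [Finset.sum_filter_of_ne]
    intro e _ hne
    have : a ∈ block e.1.1 := e.2.support_subset
      (Finsupp.mem_support_iff.2 fun h0 => hne (by rw [h0, mul_zero]))
    rw [← unpair_fst_of_mem_block this, unpair_fst_of_mem_block ha]
  have hc0 : c = 0 := by
    refine eq_zero_of_evalSparse_torsion p k c (fun a => ?_) ?_
    · by_cases ha : ∃ m, a ∈ block m
      · obtain ⟨m, ha⟩ := ha
        rw [hca m a ha]
        have hma : (m : ℤ) ≤ a := by exact_mod_cast le_of_mem_block ha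
        calc _ ≤ ∑ e ∈ F m, |n e * e.1.2 a| := Finset.abs_sum_le_sum_abs _ _
          _ ≤ ∑ e ∈ F m, |n e| * (p : ℤ) ^ k := Finset.sum_le_sum fun e _ => by
              rw [abs_mul]
              gcongr
              exact_mod_cast e.2.abs_le a
          _ = (∑ e ∈ F m, |n e|) * (p : ℤ) ^ k := (Finset.sum_mul _ _ _).symm
          _ ≤ _ := by
              gcongr
              linarith [hFsum m]
      · have : c a = 0 := by
          rw [hc, Finsupp.finsetSum_apply]
          refine Finset.sum_eq_zero fun e _ => ?_
          rw [Finsupp.smul_apply, Finsupp.notMem_support_iff.1 fun h0 =>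
            ha ⟨_, e.2.support_subset h0⟩, smul_zero]
        rw [this, abs_zero]
        positivity
    · rw [linearCombination_gen, smul_add, smul_comm, hx, smul_zero, zero_add] at h
      exact h
  have hdvd : ∀ m, (p : ℤ) ^ k ∣ ∑ e ∈ F m, n e := fun m => by
    have hcard : (F m).card ≤ m := by
      have : ((F m).card : ℤ) ≤ m := by
        calc ((F m).card : ℤ) = ∑ e ∈ F m, (1 : ℤ) := by simp
          _ ≤ ∑ e ∈ F m, |n e| := Finset.sum_le_sum fun e he => by
              have := Finsupp.mem_support_iff.1 (Finset.mem_filter.1 he).1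
              exact Int.one_le_abs this
          _ ≤ m := hFsum m
      exact_mod_cast this
    -- At most `m * defect m < blockSize m` coordinates are exceptional for some `e ∈ F m`.
    obtain ⟨a, ha, hgood⟩ : ∃ a ∈ block m, ∀ e ∈ F m, (p : ℤ) ^ k ∣ e.1.2 a - 1 := by
      by_contra! hcon
      have hsub : block m ⊆ (F m).biUnion fun e =>
          (block m).filter fun a => ¬ ((p ^ k : ℕ) : ℤ) ∣ e.1.2 a - 1 := fun a ha => by
        obtain ⟨e, he, hne⟩ := hcon a ha
        exact Finset.mem_biUnion.2 ⟨e, he, Finset.mem_filter.2 ⟨ha, by exact_mod_cast hne⟩⟩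
      have h1 := (Finset.card_le_card hsub).trans
        (Finset.card_biUnion_le_card_mul _ _ (defect m) fun e he => by
          have := e.2.card_le
          rwa [(Finset.mem_filter.1 he).2] at this)
      rw [card_block] at h1
      have h2 : blockSize m ≤ m * defect m := h1.trans (Nat.mul_le_mul_right _ hcard)
      have h3 : blockSize m = m * defect m + defect m := by unfold blockSize defect; ring
      have h4 : 0 < defect m := by unfold defect; positivity
      omega
    have h0 : ∑ e ∈ F m, n e * e.1.2 a = 0 := by rw [← hca m a ha, hc0]; rfl
    have h1 : ∑ e ∈ F m, n e = -∑ e ∈ F m, n e * (e.1.2 a - 1) := by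
      simp only [mul_sub, mul_one, Finset.sum_sub_distrib, h0]
      ring
    rw [h1, dvd_neg]
    exact Finset.dvd_sum fun e he => (hgood e he).mul_left _
  have hs : (p : ℤ) ^ k ∣ ∑ e ∈ n.support, n e := by
    rw [← Finset.sum_fiberwise_of_maps_to (t := n.support.image fun e => e.1.1)
      (g := fun e => e.1.1) fun e he => Finset.mem_image_of_mem _ he]
    exact Finset.dvd_sum fun m _ => hdvd m
  obtain ⟨d, hd⟩ := hs
  rw [linearCombination_gen, ← hc, hc0, map_zero, add_zero, hd, mul_comm, mul_smul, hx, smul_zero]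

/-! ### Homomorphisms into compact groups. -/

/-- The vector on the `m`-th block with prescribed residues. -/
noncomputable def liftBlock {q : ℕ} (m : ℕ) (w : Fin (blockSize m) → ZMod q) : ℕ →₀ ℤ :=
  Finsupp.embDomain (blockEmb m) (Finsupp.equivFunOnFinite.symm fun i => ((w i).val : ℤ))

theorem isNearlyOne_sub {q : ℕ} [NeZero q] {m : ℕ} {w w' : Fin (blockSize m) → ZMod q}
    (h : hammingDist w (w' + 1) ≤ defect m) :
    IsNearlyOne q m (liftBlock m w - liftBlock m w') := by
  classical
  have hout : ∀ a, a ∉ block m → (liftBlock m w - liftBlock m w') a = 0 := fun a ha => by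
    have : a ∉ Set.range (blockEmb m) := by
      rintro ⟨i, rfl⟩
      exact ha (Finset.mem_map_of_mem _ (Finset.mem_univ i))
    rw [Finsupp.sub_apply, liftBlock, liftBlock, Finsupp.embDomain_of_notMem_range _ _ _ this,
      Finsupp.embDomain_of_notMem_range _ _ _ this, sub_zero]
  have hin : ∀ i, (liftBlock m w - liftBlock m w') (blockEmb m i) =
      ((w i).val : ℤ) - ((w' i).val : ℤ) := fun i => by
    rw [Finsupp.sub_apply, liftBlock, liftBlock, Finsupp.embDomain_apply_self,
      Finsupp.embDomain_apply_self]
    rfl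
  refine ⟨fun a ha => ?_, fun a => ?_, ?_⟩
  · by_contra hb
    exact Finsupp.mem_support_iff.1 ha (hout a hb)
  · by_cases hb : a ∈ block m
    · obtain ⟨i, -, rfl⟩ := Finset.mem_map.1 hb
      rw [hin]
      have h1 := ZMod.val_lt (w i)
      have h2 := ZMod.val_lt (w' i)
      rw [abs_le]
      constructor <;> omega
    · rw [hout a hb, abs_zero]; positivity
  · refine le_trans ?_ h
    unfold hammingDist
    rw [← Finset.card_map (blockEmb m)]
    refine Finset.card_le_card fun a ha => ?_
    obtain ⟨hb, hne⟩ := Finset.mem_filter.1 ha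
    obtain ⟨i, -, rfl⟩ := Finset.mem_map.1 hb
    refine Finset.mem_map_of_mem _ (Finset.mem_filter.2 ⟨Finset.mem_univ i, fun heq => hne ?_⟩)
    rw [hin, ← ZMod.intCast_zmod_eq_zero_iff_dvd _ q]
    push_cast
    rw [ZMod.natCast_zmod_val, ZMod.natCast_zmod_val, heq]
    simp

/-- Every homomorphism into a compact group under which the generators tend to zero kills `x`. -/
theorem map_eq_zero_of_small {K : Type*} [AddGroup K] [TopologicalSpace K]
    [IsTopologicalAddGroup K] [CompactSpace K] [T2Space K] {x : PruferGroup p}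
    (φ : PruferGroup p →+ K)
    (hφ : ∀ V ∈ nhds (0 : K), ∃ ε > 0, ∀ e : GenIndex p k, genWeight e < ε → φ (gen x e) ∈ V) :
    φ x = 0 := by
  classical
  by_contra hne
  have : NeZero (p ^ k) := ⟨pow_ne_zero _ (Fact.out : p.Prime).ne_zero⟩
  -- `K` need not be commutative: `-b + c` is ordered so that a common left translate cancels.
  obtain ⟨V, hV, hVx⟩ : ∃ V ∈ nhds (0 : K), ∀ a ∈ V, ∀ b ∈ V, ∀ c ∈ V, a - (-b + c) ≠ φ x := by
    have hcont : Continuous fun y : K × K × K => y.1 - (-y.2.1 + y.2.2) := by fun_prop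
    have hmem : {y : K × K × K | y.1 - (-y.2.1 + y.2.2) ≠ φ x} ∈ nhds ((0, 0, 0) : K × K × K) := by
      refine (isOpen_ne.preimage hcont).mem_nhds ?_
      simpa using Ne.symm hne
    obtain ⟨A, hA, B, hB, hAB⟩ := mem_nhds_prod_iff.1 hmem
    obtain ⟨B₁, hB₁, B₂, hB₂, hBB⟩ := mem_nhds_prod_iff.1 hB
    exact ⟨A ∩ (B₁ ∩ B₂), Filter.inter_mem hA (Filter.inter_mem hB₁ hB₂),
      fun a ha b hb c hc => hAB (Set.mk_mem_prod ha.1 (hBB (Set.mk_mem_prod hb.2.1 hc.2.2)))⟩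
  obtain ⟨t, ht⟩ := compact_covered_by_add_left_translates (isCompact_univ (X := K))
    ⟨0, mem_interior_iff_mem_nhds.2 hV⟩
  have hcov : ∀ y : K, ∃ g ∈ t, g + y ∈ V := fun y => by
    simpa using ht (Set.mem_univ y)
  choose col hcol hcolV using hcov
  obtain ⟨ε, hε, hεV⟩ := hφ V hV
  obtain ⟨m₀, hm₀⟩ := exists_nat_one_div_lt hε
  -- `m₀` makes block-`m` generators small; `t.card` leaves at most `m` colours, so some class has
  -- density at least `1 / (m + 1)`.
  set m := max m₀ t.card with hm
  set y : (Fin (blockSize m) → ZMod (p ^ k)) → K := fun w => φ (evalSparse p k (liftBlock m w))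
  obtain ⟨g, -, hg⟩ : ∃ g ∈ t, Fintype.card (ZMod (p ^ k)) ^ blockSize m ≤
      (m + 1) * (Finset.univ.filter fun w => col (y w) = g).card := by
    by_contra! hcon
    have htn : t.Nonempty := ⟨_, hcol 0⟩
    have h1 := Finset.card_eq_sum_card_fiberwise (s := Finset.univ) (t := t)
      (f := fun w => col (y w)) fun w _ => hcol _
    have h2 := Finset.sum_lt_sum_of_nonempty htn hcon
    rw [← Finset.mul_sum, ← h1, Finset.sum_const, smul_eq_mul, Finset.card_univ,
      Fintype.card_fun, Fintype.card_fin] at h2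
    have h3 := Nat.lt_of_mul_lt_mul_right h2
    have h4 : t.card ≤ m := le_max_right _ _
    omega
  set C := Finset.univ.filter fun w => col (y w) = g with hC
  -- The sizes are tuned so that `4 * (m + 1) * blockSize m = defect m ^ 2`.
  obtain ⟨w, hw, w₁, hw₁, hdist⟩ := exists_hammingDist_le (t := defect m) (d := blockSize m)
    (by unfold defect blockSize; rw [Nat.succ_eq_add_one]; apply le_of_eq; ring) m.succ_pos C
    (C.image fun w => w + 1) hg (by
      rwa [Finset.card_image_of_injective _ (add_left_injective _)])
  obtain ⟨w', hw', rfl⟩ := Finset.mem_image.1 hw₁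
  have hv := isNearlyOne_sub hdist
  have hsmall := hεV ⟨(m, _), hv⟩ (by
    refine lt_of_le_of_lt ?_ hm₀
    unfold genWeight
    have : (m₀ : ℝ) ≤ m := by exact_mod_cast le_max_left _ _
    gcongr)
  have ha := hcolV (y w)
  have hb := hcolV (y w')
  rw [(Finset.mem_filter.1 hw).2] at ha
  rw [(Finset.mem_filter.1 hw').2] at hb
  refine hVx _ hsmall _ hb _ ha ?_
  have hd : -(g + y w') + (g + y w) =
      φ (evalSparse p k (liftBlock m w - liftBlock m w')) := by
    rw [map_sub, sub_eq_neg_add, map_add, map_neg, neg_add_rev, add_assoc, neg_add_cancel_left]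
  rw [hd, gen, map_add, add_sub_cancel_right]

end PruferGroup

/-! ### The topology and its radical. -/

theorem theoremB (p : ℕ) (hp : p.Prime) (x : PruferGroup p) (hx : x ≠ 0) :
    ∃ τ : TopologicalSpace (PruferGroup p),
      IsTopologicalAddGroup (PruferGroup p) ∧ T2Space (PruferGroup p) ∧
        vonNeumannRadical (PruferGroup p) = AddSubgroup.zmultiples x := by
  have : Fact p.Prime := ⟨hp⟩
  obtain ⟨k, hk⟩ := PruferGroup.exists_zmultiples_eq_torsion p x
  have hkx : ((p : ℤ) ^ k) • x = 0 := (hk x).1 (AddSubgroup.mem_zmultiples x)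
  let B := weightedBasis PruferGroup.genWeight PruferGroup.genWeight_nonneg
    (PruferGroup.gen (k := k) x)
  have hbasis := weightedBasis_hasBasis PruferGroup.genWeight PruferGroup.genWeight_nonneg
    (PruferGroup.gen (k := k) x)
  let _ : TopologicalSpace (PruferGroup p) := B.topology
  have hgrp : IsTopologicalAddGroup (PruferGroup p) := B.isTopologicalAddGroup
  have hχ := PruferGroup.norm_powCharacter_gen_le (k := k) hkx
  refine ⟨inferInstance, hgrp, ?_, ?_⟩
  · refine IsTopologicalAddGroup.t2Space_of_zero_sep fun g hg => ?_
    by_contra! hcon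
    have hmem : ∀ ε > 0, g ∈ weightedBall PruferGroup.genWeight (PruferGroup.gen (k := k) x) ε :=
      fun ε hε => hcon _ (hbasis.mem_of_mem hε)
    have hχg : PruferGroup.powCharacter p k g = 0 := by
      rw [← norm_le_zero_iff]
      exact le_of_forall_pos_lt_add fun ε hε => by
        simpa using norm_lt_of_mem_weightedBall _ hχ (hmem ε hε)
    -- All radii were needed to place `g` in the torsion; radius `1` then suffices to make it zero.
    obtain ⟨n, hn, rfl⟩ := hmem 1 one_pos
    exact hg (PruferGroup.linearCombination_gen_eq_zero hkx n hn
      ((PruferGroup.powCharacter_eq_zero_iff p k _).1 hχg))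
  · ext g
    constructor
    · intro hg
      rw [hk, ← PruferGroup.powCharacter_eq_zero_iff]
      refine hg UnitAddCircle (PruferGroup.powCharacter p k) ?_
      refine continuous_of_continuousAt_zero _ ?_
      rw [ContinuousAt, map_zero]
      refine (hbasis.tendsto_iff Metric.nhds_basis_ball).2 fun ε hε => ⟨ε, hε, fun h hh => ?_⟩
      rw [mem_ball_zero_iff]
      exact norm_lt_of_mem_weightedBall _ hχ hh
    · revert g
      change AddSubgroup.zmultiples x ≤ _
      rw [AddSubgroup.zmultiples_le]
      intro K _ _ _ _ _ φ hφ
      refine PruferGroup.map_eq_zero_of_small (k := k) φ fun V hV => ?_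
      have hV' : φ ⁻¹' V ∈ nhds (0 : PruferGroup p) :=
        hφ.continuousAt.preimage_mem_nhds (by rwa [map_zero])
      obtain ⟨ε, hε, hsub⟩ := hbasis.mem_iff.1 hV'
      exact ⟨ε, hε, fun e he => hsub (mem_weightedBall he)⟩
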